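/- Call a real algebraic integer $>1$ a Pisot number if all of its other algebraic conjugates have modulus less than $1$. Let $\theta=1/\alpha$ be a Pisot number with $\theta>2$, let $\ell$ be an integer with $2\le \ell<\theta$, let $a_1,\dots,a_\ell\in\mathbb Z[\theta]$, and let $E\subset\mathbb R$ be the attractor of $\{\phi_i(x)=\alpha x+a_i\}_{i=1}^{\ell}$, i.e. the unique non-empty compact set with $E=\bigcup_{i=1}^{\ell}\phi_i(E)$. Let $F\subset\mathbb R$ be the attractor of a finite family $\{\psi_j(x)=\beta_jO_j(x)+b_j\}_{j=1}^{m}$, where $0<\beta_j<1$, $b_j\in\mathbb R$ and each $O_j$ is an orthogonal transformation of $\mathbb R$ (that is, $O_j(x)=x$ or $O_j(x)=-x$), and suppose that $F$ is not a singleton. If $F$ can be affinely embedded into $E$, i.e. if there are $c,a\in\mathbb R$ with $c\ne0$ and $cF+a\subseteq E$, then for every $j=1,\dots,m$ one has $\log\beta_j/\log\alpha\in\mathbb Q$ and $1/\beta_j$ is a Pisot number. -/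

import Mathlib

/-- A Pisot number: a real algebraic integer `θ > 1` all of whose other algebraic conjugates
(the other complex roots of its minimal polynomial over `ℚ`) have modulus less than `1`. -/
def IsPisot (θ : ℝ) : Prop :=
  IsIntegral ℤ θ ∧ 1 < θ ∧
    ∀ z : ℂ, Polynomial.aeval z (minpoly ℚ θ) = 0 → z ≠ (θ : ℂ) → ‖z‖ < 1

/-- `K` is the attractor of the finite family of maps `φ` on `ℝ`: the non-empty compact set with
`K = ⋃ i, φ i (K)`. For contractions this set exists and is unique (Hutchinson). -/
def IsAttractor {n : ℕ} (φ : Fin n → ℝ → ℝ) (K : Set ℝ) : Prop :=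
  K.Nonempty ∧ IsCompact K ∧ K = ⋃ i, φ i '' K

/-- The similitude `x ↦ r R(x) + a` of the line, with ratio `r`, orthogonal transformation `R`
of `ℝ` and translation `a`. -/
def similitude (r : ℝ) (R : ℝ ≃ₗᵢ[ℝ] ℝ) (a : ℝ) : ℝ → ℝ :=
  fun x => r * R x + a

/-- `A ⊆ ℝ` can be affinely embedded into `B ⊆ ℝ`: some invertible affine map
`x ↦ c x + a`, `c ≠ 0`, sends `A` into `B`. -/
def AffinelyEmbeds (A B : Set ℝ) : Prop :=
  ∃ c a : ℝ, c ≠ 0 ∧ (fun x => c * x + a) '' A ⊆ B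

/-!
Write `Y` for the union of the blow-ups `θᵐ E`, and `f` for the minimal polynomial of `θ`.

**`E` is null for a strong arithmetic reason.** Expanding a point of `E` digit by digit gives
`θᵐ x = G(θ) + x'` with `x' ∈ E` and `G ∈ ℤ[X]`, where `G` stays bounded at the other conjugates of `θ`
because `θ` is a Pisot number. Hence the image of `Y` in the torus `ℝ[X]/(f)` modulo `ℤ[X]/(f)`, along
the eigenline of multiplication by `X` for the eigenvalue `θ`, lies in the image of a compact set of
polynomials whose values at `θ` belong to `E`. That set is null, as `l < θ` forces `E` to be null. A
trigonometric polynomial on the torus that is close to `1` on this set and has small mean restricts to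
a trigonometric sum on `Y`, with nonzero frequencies in `ℚ(θ)`
(`IsPisot.exists_trigSum_near_one`). Averaging it over the vertices of a cube `u + ∑ εₖ xₖ`,
`εₖ ∈ {0, 1}`, contained in `Y` shows that for one of finitely many frequencies `s` the Riesz product
`∏ |cos (π s xₖ)|` is bounded below by a constant independent of the cube
(`IsPisot.exists_frequencies`).

**`F` contains many cubes.** If two similitudes `g, h` preserve `F` and do not commute, then `g ∘ h` and
`h ∘ g` have the same ratio `γ` and different translations, so `F`, and with it `E`, contains cubes
with sides `D γᵏ`, `k < n`, for every `n` (`exists_cube_subset`). In `Y` these become cubes with sides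
`θᵐ D γᵏ`.

**Consequences for `γ`.** If `log |γ| / log θ` were irrational, the numbers `θᵐ |γ|ⁿ` would be dense in
the half-line, and some such cube would have all its Riesz products small
(`rational_log_div_log_of_prod_cos_ge`). So `γ⁻¹` and `θ` have a common power up to sign; then the sides
run through `D γ⁻ⁱ`, and the bounded Riesz product forces `s D γ⁻ⁱ` to approach the integers. The
algebraic case of Pisot's theorem (`mem_adjoin_of_tendsto_sub_int`), applied along powers of `θ`, gives
`s D, s D γ⁻¹ ∈ ℚ(θ)`, hence `γ ∈ ℚ(θ)` (`mem_adjoin_of_prod_cos_ge`).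

Since `F` is not a singleton, each `ψ_j` fails to commute with some `ψ_i`. The pairs `(ψ_j, ψ_i)` and
`(ψ_j ∘ ψ_j, ψ_i)` yield two values of `γ` whose quotient is the signed ratio of `ψ_j`. So `1 / β_j` is
an element of `ℚ(θ)` with a power equal to a power of `θ`, and such a number greater than `1` is Pisot
(`IsPisot.of_pow_eq_pow`).
-/

open MeasureTheory Set Polynomial
open scoped Pointwise IntermediateField

/-! ### Trigonometric polynomials close to one on a null set -/

theorem UnitAddTorus.mFourier_coe {d : ℕ} (q : Fin d → ℤ) (w : Fin d → ℝ) :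
    UnitAddTorus.mFourier q (fun i => (w i : UnitAddCircle)) =
      Complex.exp (2 * Real.pi * Complex.I * ((∑ i, q i * w i : ℝ) : ℂ)) := by
  simp only [UnitAddTorus.mFourier, ContinuousMap.coe_mk, fourier_coe_apply]
  rw [← Complex.exp_sum]
  congr 1
  push_cast
  rw [Finset.mul_sum]
  refine Finset.sum_congr rfl fun i _ => ?_
  ring

theorem integral_cube_mFourier {d : ℕ} {q : Fin d → ℤ} (hq : q ≠ 0) :
    ∫ w in Set.univ.pi fun _ : Fin d => Ioc (0 : ℝ) 1,
      UnitAddTorus.mFourier q (fun i => (w i : UnitAddCircle)) = 0 := by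
  rw [volume_pi, Measure.restrict_pi_pi]
  simp only [UnitAddTorus.mFourier, ContinuousMap.coe_mk]
  rw [integral_fintype_prod_eq_prod (𝕜 := ℂ) (fun i (x : ℝ) => fourier (q i) (x : UnitAddCircle))]
  obtain ⟨i, hi⟩ := Function.ne_iff.mp hq
  refine Finset.prod_eq_zero (Finset.mem_univ i) ?_
  rw [← intervalIntegral.integral_of_le zero_le_one]
  have := fourierCoeff_eq_intervalIntegral (T := 1) (fun x : UnitAddCircle => fourier (q i) x) 0 0
  simp only [neg_zero, fourier_zero, one_smul, zero_add, div_one] at this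
  rw [← this]
  have h2 := (orthonormal_iff_ite.mp (orthonormal_fourier (T := 1))) 0 (q i)
  rw [if_neg (by simpa [eq_comm] using hi)] at h2
  rw [fourierCoeff]
  simp only [ContinuousMap.inner_toLp, ← fourier_neg, ← fourier_add] at h2
  simpa [mul_comm] using h2

/-- A compact null set in `ℝᵈ` is, modulo `ℤᵈ`, closed and null in the torus, so Urysohn's lemma and
the density of trigonometric polynomials give one close to `1` on it with small mean. -/
theorem exists_trigPoly_near_one_of_null {d : ℕ} {K : Set (Fin d → ℝ)} (hK : IsCompact K)
    (h0 : volume K = 0) :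
    ∃ c : (Fin d → ℤ) →₀ ℂ, ‖c 0‖ ≤ 1 / 2 ∧ ∀ (w : Fin d → ℝ) (n : Fin d → ℤ),
      (fun i => w i + n i) ∈ K →
      ‖(c.sum fun q a => a * Complex.exp (2 * Real.pi * Complex.I * ((∑ i, q i * w i : ℝ) : ℂ))) - 1‖
        ≤ 1 / 4 := by
  let π : (Fin d → ℝ) → UnitAddTorus (Fin d) := fun w i => (w i : UnitAddCircle)
  have hπ : Continuous π := continuous_pi fun i => (AddCircle.continuous_mk' 1).comp (continuous_apply i)
  let Q : Set (Fin d → ℝ) := Set.univ.pi fun _ : Fin d => Ioc (0 : ℝ) 1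
  let μ : Measure (UnitAddTorus (Fin d)) := (volume.restrict Q).map π
  have hQ : volume Q = 1 := by simp [Q, Real.volume_pi_Ioc]
  have hfin : IsProbabilityMeasure (volume.restrict Q) := ⟨by simp [hQ]⟩
  have hμ : IsProbabilityMeasure μ := Measure.isProbabilityMeasure_map hπ.aemeasurable
  have hWc : IsCompact (π '' K) := hK.image hπ
  -- the preimage of the image is a countable union of translates
  have hpre : π ⁻¹' (π '' K) ⊆ ⋃ n : Fin d → ℤ, (fun w => w + fun i => (n i : ℝ)) ⁻¹' K := by
    rintro w ⟨k, hk, hkw⟩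
    have : ∀ i, ∃ n : ℤ, k i = w i + n := fun i => by
      have h := congrFun hkw i
      simp only [π] at h
      obtain ⟨n, hn⟩ := AddSubgroup.mem_zmultiples_iff.1 (QuotientAddGroup.eq_iff_sub_mem.1 h)
      exact ⟨n, by simp only [zsmul_eq_mul, mul_one] at hn; linarith⟩
    choose n hn using this
    refine mem_iUnion.2 ⟨n, ?_⟩
    simp only [mem_preimage]
    convert hk
    ext i; simp [hn]
  have hW0 : μ (π '' K) = 0 := by
    rw [Measure.map_apply hπ.measurable hWc.measurableSet]
    refine le_antisymm ((Measure.restrict_apply_le _ _).trans ?_) zero_le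
    refine (measure_mono hpre).trans ((measure_iUnion_le _).trans ?_)
    simp [measure_preimage_add_right, h0]
  obtain ⟨U, hWU, hUo, hUμ⟩ := Set.exists_isOpen_lt_of_lt (μ := μ) (π '' K) (ENNReal.ofReal (1/4))
    (by rw [hW0]; simp)
  obtain ⟨f, hf0, hf1, hf01⟩ := exists_continuous_zero_one_of_isClosed (s := Uᶜ) (t := π '' K)
    hUo.isClosed_compl hWc.isClosed (disjoint_compl_left_iff_subset.2 hWU)
  let F : C(UnitAddTorus (Fin d), ℂ) := ⟨fun x => (f x : ℂ), by fun_prop⟩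
  -- `0 ≤ f ≤ 1` vanishes off `U`, so its mean is at most the measure of `U`
  have hFint : ‖∫ x, F x ∂μ‖ ≤ 1 / 4 := by
    have hle : ∀ x, ‖F x‖ ≤ U.indicator (fun _ => (1 : ℝ)) x := fun x => by
      by_cases hx : x ∈ U
      · simpa [F, hx, abs_of_nonneg (hf01 x).1] using (hf01 x).2
      · simpa [F, hx] using hf0 hx
    refine (norm_integral_le_of_norm_le ((integrable_const 1).indicator hUo.measurableSet)
      (.of_forall hle)).trans ?_
    rw [integral_indicator_const _ hUo.measurableSet, smul_eq_mul, mul_one]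
    exact ENNReal.toReal_le_of_le_ofReal (by norm_num) hUμ.le
  have hFmem : F ∈
      (Submodule.span ℂ (range (UnitAddTorus.mFourier (d := Fin d)))).topologicalClosure := by
    rw [UnitAddTorus.span_mFourier_closure_eq_top]; trivial
  obtain ⟨g, hg, hgF⟩ := Metric.mem_closure_iff.1 hFmem (1/4) (by norm_num)
  obtain ⟨c, rfl⟩ := (Finsupp.mem_span_range_iff_exists_finsupp).1 hg
  rw [dist_eq_norm] at hgF
  have hval : ∀ x, ‖F x - (c.sum fun q a => a • UnitAddTorus.mFourier q) x‖ ≤ 1 / 4 := fun x =>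
    ((F - c.sum fun q a => a • UnitAddTorus.mFourier q).norm_coe_le_norm x).trans hgF.le
  have hsum : ∀ x, (c.sum fun q a => a • UnitAddTorus.mFourier q) x =
      c.sum fun q a => a * UnitAddTorus.mFourier q x := fun x => by
    simp [Finsupp.sum, ContinuousMap.sum_apply]
  have hint : ∀ h : C(UnitAddTorus (Fin d), ℂ), Integrable h μ := fun h =>
    (BoundedContinuousFunction.mkOfCompact h).integrable μ
  refine ⟨c, ?_, fun w n hwn => ?_⟩
  · have hmean : ∫ x, (c.sum fun q a => a • UnitAddTorus.mFourier q) x ∂μ = c 0 := by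
      rw [integral_congr_ae (.of_forall hsum)]
      simp only [Finsupp.sum]
      rw [integral_finsetSum _ fun q _ => (hint _).const_mul _]
      simp only [integral_const_mul]
      have hq : ∀ q, q ≠ 0 → ∫ x, UnitAddTorus.mFourier q x ∂μ = 0 := fun q hq => by
        rw [integral_map hπ.aemeasurable
          (UnitAddTorus.mFourier q).continuous.aestronglyMeasurable]
        exact integral_cube_mFourier hq
      rw [Finset.sum_eq_single 0 (fun q _ h => by rw [hq q h, mul_zero])
        (fun h => by simp [Finsupp.notMem_support_iff.1 h])]
      simp [UnitAddTorus.mFourier_zero]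
    have h1 : ‖∫ x, (F x - (c.sum fun q a => a • UnitAddTorus.mFourier q) x) ∂μ‖ ≤ 1/4 := by
      refine (norm_integral_le_of_norm_le_const (C := 1/4) (.of_forall hval)).trans ?_
      simp
    rw [integral_sub (hint _) (hint _), hmean] at h1
    have := norm_sub_norm_le (c 0) (∫ x, F x ∂μ)
    rw [norm_sub_rev] at this
    linarith
  · have h1 : F (π w) = 1 := by
      have : π w ∈ π '' K := ⟨_, hwn, by ext i; simp [π]⟩
      simpa [F] using hf1 this
    have := hval (π w)
    rw [h1, hsum, norm_sub_rev] at this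
    simpa only [π, UnitAddTorus.mFourier_coe] using this

/-! ### Riesz products of cubes -/

theorem norm_one_add_exp_half (t : ℝ) :
    ‖(1 + Complex.exp (2 * Real.pi * Complex.I * (t : ℂ))) / 2‖ = |Real.cos (Real.pi * t)| := by
  have : (1 + Complex.exp (2 * Real.pi * Complex.I * (t : ℂ))) / 2 =
      (Real.cos (Real.pi * t) : ℂ) * Complex.exp ((Real.pi * t : ℝ) * Complex.I) := by
    push_cast
    rw [Complex.cos, show (2 * Real.pi * Complex.I * (t : ℂ)) =
      Real.pi * t * Complex.I + Real.pi * t * Complex.I by ring, Complex.exp_add, neg_mul,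
      Complex.exp_neg]
    field_simp
    ring
  rw [this, norm_mul, Complex.norm_exp_ofReal_mul_I, mul_one, Complex.norm_real, Real.norm_eq_abs]

/-- Averaging a trigonometric sum over the vertices of a cube multiplies each frequency by a Riesz
product; the bound passes to the average because discs are convex. -/
theorem norm_riesz_average_sub_one_le {ι : Type*} [Fintype ι] (s : ι → ℝ) (c₀ : ℂ) (x : ℕ → ℝ) (r : ℝ)
    (n : ℕ) (b : ι → ℂ)
    (h : ∀ ε : ℕ → ℝ, (∀ k, ε k = 0 ∨ ε k = 1) → ‖c₀ + (∑ i, b i * Complex.exp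
      (2 * Real.pi * Complex.I * ((s i * ∑ k ∈ Finset.range n, ε k * x k : ℝ) : ℂ))) - 1‖ ≤ r) :
    ‖c₀ + (∑ i, b i * ∏ k ∈ Finset.range n,
      ((1 + Complex.exp (2 * Real.pi * Complex.I * ((s i * x k : ℝ) : ℂ))) / 2)) - 1‖ ≤ r := by
  induction n generalizing b with
  | zero => simpa using h 0 (fun _ => .inl rfl)
  | succ n ih =>
    have := ih (fun i => b i * ((1 + Complex.exp
      (2 * Real.pi * Complex.I * ((s i * x n : ℝ) : ℂ))) / 2)) ?_
    · simp only [Finset.prod_range_succ]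
      convert this using 5
      ring
    intro ε hε
    have key : ∀ t : ℝ, (t = 0 ∨ t = 1) → ‖c₀ + (∑ i, b i * Complex.exp
      (2 * Real.pi * Complex.I * ((s i * ((∑ k ∈ Finset.range n, ε k * x k) + t * x n) : ℝ) : ℂ)))
        - 1‖ ≤ r := fun t ht => by
      have h1 := h (Function.update ε n t) (fun k => by
        by_cases hk : k = n
        · subst hk; simpa using ht
        · simpa [hk] using hε k)
      rw [Finset.sum_range_succ, Finset.sum_congr rfl (g := fun k => ε k * x k)] at h1
      · simpa using h1
      · intro k hk
        rw [Function.update_of_ne (Finset.mem_range.1 hk).ne]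
    have h0 := key 0 (.inl rfl)
    have h1 := key 1 (.inr rfl)
    have hmid : c₀ + (∑ i, (b i * ((1 + Complex.exp
        (2 * Real.pi * Complex.I * ((s i * x n : ℝ) : ℂ))) / 2)) * Complex.exp
        (2 * Real.pi * Complex.I * ((s i * ∑ k ∈ Finset.range n, ε k * x k : ℝ) : ℂ))) - 1 =
      (1 / 2 : ℂ) * (c₀ + (∑ i, b i * Complex.exp
      (2 * Real.pi * Complex.I * ((s i * ((∑ k ∈ Finset.range n, ε k * x k) + 0 * x n) : ℝ) : ℂ)))
        - 1) + (1 / 2 : ℂ) * (c₀ + (∑ i, b i * Complex.exp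
      (2 * Real.pi * Complex.I * ((s i * ((∑ k ∈ Finset.range n, ε k * x k) + 1 * x n) : ℝ) : ℂ)))
        - 1) := by
      have : ∀ A B : ℂ, (1 / 2 : ℂ) * (c₀ + A - 1) + 1 / 2 * (c₀ + B - 1) = c₀ + (A + B) / 2 - 1 :=
        fun A B => by ring
      rw [this, ← Finset.sum_add_distrib, Finset.sum_div]
      congr 2
      refine Finset.sum_congr rfl fun i _ => ?_
      rw [zero_mul, add_zero, one_mul, mul_add]
      push_cast
      rw [mul_add, Complex.exp_add]
      ring
    rw [hmid]
    refine (norm_add_le _ _).trans ?_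
    rw [norm_mul, norm_mul]
    have : ‖(1 / 2 : ℂ)‖ = 1 / 2 := by norm_num
    rw [this]
    linarith

/-- If a trigonometric sum of small mean is close to `1` on all vertices of a cube, then one of its
Riesz products stays away from `0`. -/
theorem exists_prod_cos_ge {ι : Type*} [Fintype ι] (s : ι → ℝ) (c₀ : ℂ) (hc₀ : ‖c₀‖ ≤ 1 / 2)
    (b : ι → ℂ) (n : ℕ) (x : ℕ → ℝ) (u : ℝ)
    (h : ∀ ε : ℕ → ℝ, (∀ k, ε k = 0 ∨ ε k = 1) → ‖c₀ + (∑ i, b i * Complex.exp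
      (2 * Real.pi * Complex.I * ((s i * (u + ∑ k ∈ Finset.range n, ε k * x k) : ℝ) : ℂ))) - 1‖
        ≤ 1 / 4) :
    ∃ i, 1 / (4 * (∑ i, ‖b i‖ + 1)) ≤ ∏ k ∈ Finset.range n, |Real.cos (Real.pi * (s i * x k))| := by
  have h1 := norm_riesz_average_sub_one_le s c₀ x (1 / 4) n
    (fun i => b i * Complex.exp (2 * Real.pi * Complex.I * ((s i * u : ℝ) : ℂ))) (fun ε hε => by
      have hε' := h ε hε
      simp only [mul_add, Complex.ofReal_add, Complex.exp_add] at hε'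
      simpa only [mul_assoc] using hε')
  set A := ∑ i, b i * Complex.exp (2 * Real.pi * Complex.I * ((s i * u : ℝ) : ℂ)) *
    ∏ k ∈ Finset.range n,
      ((1 + Complex.exp (2 * Real.pi * Complex.I * ((s i * x k : ℝ) : ℂ))) / 2)
  have hA : 1 / 4 ≤ ‖A‖ := by
    have h2 : (1 : ℂ) = c₀ + A - (c₀ + A - 1) := by ring
    have h3 : ‖(1 : ℂ)‖ ≤ ‖c₀ + A‖ + ‖c₀ + A - 1‖ := by
      conv_lhs => rw [h2]
      exact norm_sub_le _ _
    rw [norm_one] at h3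
    have := norm_add_le c₀ A
    linarith
  have hA2 : ‖A‖ ≤ ∑ i, ‖b i‖ * ∏ k ∈ Finset.range n, |Real.cos (Real.pi * (s i * x k))| := by
    refine (norm_sum_le _ _).trans (le_of_eq (Finset.sum_congr rfl fun i _ => ?_))
    rw [norm_mul, norm_mul, norm_prod]
    congr 1
    · have : 2 * Real.pi * Complex.I * ((s i * u : ℝ) : ℂ) =
        ((2 * Real.pi * (s i * u) : ℝ) : ℂ) * Complex.I := by push_cast; ring
      rw [this, Complex.norm_exp_ofReal_mul_I, mul_one]
    · exact Finset.prod_congr rfl fun k _ => norm_one_add_exp_half _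
  by_contra! hlt
  have hB : 0 ≤ ∑ i, ‖b i‖ := Finset.sum_nonneg fun i _ => norm_nonneg _
  have : ∑ i, ‖b i‖ * ∏ k ∈ Finset.range n, |Real.cos (Real.pi * (s i * x k))| ≤
      ∑ i, ‖b i‖ * (1 / (4 * (∑ i, ‖b i‖ + 1))) :=
    Finset.sum_le_sum fun i _ => mul_le_mul_of_nonneg_left (hlt i).le (norm_nonneg _)
  rw [← Finset.sum_mul] at this
  have h4 : (∑ i, ‖b i‖) * (1 / (4 * (∑ i, ‖b i‖ + 1))) < 1 / 4 := by
    rw [mul_one_div, div_lt_div_iff₀ (by positivity) (by norm_num)]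
    linarith
  linarith

/-! ### Blow-ups of a self-similar set with Pisot ratio -/

theorem volume_eq_zero_of_subset_iUnion_image {l : ℕ} {α : ℝ} (hα : 0 < α) (hlα : l * α < 1)
    (a : Fin l → ℝ) {E : Set ℝ} (hE : IsCompact E) (hsub : E ⊆ ⋃ i, (fun x => α * x + a i) '' E) :
    volume E = 0 := by
  have himg : ∀ i, volume ((fun x => α * x + a i) '' E) = ENNReal.ofReal α * volume E := fun i => by
    have : (fun x => α * x + a i) '' E = (fun x => x + a i) '' (α • E) := by
      ext y; simp [Set.mem_smul_set, ← sub_eq_add_neg, eq_sub_iff_add_eq]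
    rw [this, image_add_right, measure_preimage_add_right, Measure.addHaar_smul]
    simp [abs_of_pos hα]
  have h1 : volume E ≤ (l * ENNReal.ofReal α) * volume E := by
    calc volume E ≤ ∑ i, volume ((fun x => α * x + a i) '' E) :=
          (measure_mono hsub).trans (measure_iUnion_fintype_le _ _)
      _ = _ := by simp [himg, mul_assoc]
  by_contra h0
  have hlt : (l * ENNReal.ofReal α) < 1 := by
    rw [← ENNReal.ofReal_natCast, ← ENNReal.ofReal_mul (by positivity)]
    exact ENNReal.ofReal_lt_one.2 hlα
  have := ENNReal.mul_lt_mul_left h0 hE.measure_lt_top.ne hlt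
  rw [one_mul] at this
  exact absurd h1 (not_le.2 this)

/-- Peeling off `m` digits of a point of `E` leaves an integral polynomial in `θ` and a point of `E`. The
polynomial is bounded at any `z` in the open unit disc, being a sum `∑ g_{iₖ}(z) zᵏ` with the `g_i`
among the finitely many polynomials that represent the `a i`. -/
theorem exists_blowup_eq_aeval_add {θ α : ℝ} (hθα : θ * α = 1) {l : ℕ} {a : Fin l → ℝ}
    (ha : ∀ i, a i ∈ Algebra.adjoin ℤ ({θ} : Set ℝ)) {E : Set ℝ}
    (hsub : E ⊆ ⋃ i, (fun x => α * x + a i) '' E) (Z : Finset ℂ) (hZ : ∀ z ∈ Z, ‖z‖ < 1) :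
    ∃ C : ℝ, ∀ m : ℕ, ∀ x ∈ E, ∃ G : ℤ[X], ∃ x' ∈ E, θ ^ m * x = aeval θ G + x' ∧
      ∀ z ∈ Z, ‖aeval z G‖ ≤ C := by
  have : ∀ i, ∃ g : ℤ[X], aeval θ g = a i := fun i => by
    have := ha i
    rwa [Algebra.adjoin_singleton_eq_range_aeval] at this
  choose g hg using this
  let B : ℝ := ∑ i, ∑ z ∈ Z, ‖aeval z (g i)‖
  have hB0 : 0 ≤ B := Finset.sum_nonneg fun i _ => Finset.sum_nonneg fun z _ => norm_nonneg _
  have hB : ∀ i, ∀ z ∈ Z, ‖aeval z (g i)‖ ≤ B := fun i z hz =>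
    (Finset.single_le_sum (f := fun z => ‖aeval z (g i)‖) (fun z _ => norm_nonneg _) hz).trans
      (Finset.single_le_sum (f := fun i => ∑ z ∈ Z, ‖aeval z (g i)‖)
        (fun i _ => Finset.sum_nonneg fun z _ => norm_nonneg _) (Finset.mem_univ i))
  have hnn : ∀ z ∈ Z, 0 ≤ B / (1 - ‖z‖) := fun z hz => div_nonneg hB0 (by linarith [hZ z hz])
  let C : ℝ := ∑ z ∈ Z, B / (1 - ‖z‖)
  have hC : ∀ z ∈ Z, B / (1 - ‖z‖) ≤ C := fun z hz => Finset.single_le_sum hnn hz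
  refine ⟨C, fun m => ?_⟩
  induction m with
  | zero => exact fun x hx => ⟨0, x, hx, by simp, fun z hz => by
      simpa using (hnn z hz).trans (hC z hz)⟩
  | succ m ih =>
    intro x hx
    obtain ⟨G, x', hx', hG, hGC⟩ := ih x hx
    obtain ⟨i, y, hy, hyx⟩ := mem_iUnion.1 (hsub hx')
    refine ⟨X * (G + g i), y, hy, ?_, fun z hz => ?_⟩
    · simp only at hyx
      rw [pow_succ', mul_assoc, hG, ← hyx]
      simp only [map_mul, aeval_X, map_add, hg]
      linear_combination y * hθα
    · have h1 : 0 < 1 - ‖z‖ := by linarith [hZ z hz]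
      have h2 := (div_le_iff₀ h1).1 (hC z hz)
      have h3 : ‖aeval z (G + g i)‖ ≤ C + B := by
        rw [map_add]
        exact (norm_add_le _ _).trans (add_le_add (hGC z hz) (hB i z hz))
      rw [map_mul, aeval_X, norm_mul]
      nlinarith [norm_nonneg z, mul_le_mul_of_nonneg_left h3 (norm_nonneg z)]

/-- Lagrange interpolation bounds the coefficients of a polynomial by its values at sufficiently
many nodes. -/
theorem exists_norm_coeff_le_of_card (Z : Finset ℂ) (C : ℝ) :
    ∃ C' : ℝ, ∀ w : ℂ[X], w.degree < Z.card → (∀ z ∈ Z, ‖w.eval z‖ ≤ C) → ∀ i, ‖w.coeff i‖ ≤ C' := by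
  classical
  let L : ℂ → ℂ[X] := fun z => Lagrange.basis Z id z
  let D : ℝ := ∑ z ∈ Z, ∑ j ∈ (L z).support, ‖(L z).coeff j‖
  have hD : ∀ z ∈ Z, ∀ i, ‖(L z).coeff i‖ ≤ ∑ j ∈ (L z).support, ‖(L z).coeff j‖ := fun z _ i => by
    by_cases hi : i ∈ (L z).support
    · exact Finset.single_le_sum (f := fun j => ‖(L z).coeff j‖) (fun _ _ => norm_nonneg _) hi
    · rw [notMem_support_iff.1 hi, norm_zero]
      exact Finset.sum_nonneg fun _ _ => norm_nonneg _
  refine ⟨C * D, fun w hw hwC i => ?_⟩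
  rw [Lagrange.eq_interpolate (s := Z) (v := id) (Function.injective_id.injOn) hw,
    Lagrange.interpolate_apply, finsetSum_coeff]
  refine (norm_sum_le _ _).trans ?_
  rw [Finset.mul_sum]
  refine Finset.sum_le_sum fun z hz => ?_
  rw [coeff_C_mul, norm_mul]
  exact mul_le_mul (hwC z hz) (hD z hz i) (norm_nonneg _) ((norm_nonneg _).trans (hwC z hz))

/-- The coefficients of `f / (X - t)`, for `f` the minimal polynomial of `t`, are linearly independent
over `ℤ`: the `i`-th one is a monic polynomial of degree `deg f - 1 - i` in `t`. -/
theorem sum_coeff_divByMonic_minpoly_ne_zero {t : ℝ} (ht : IsIntegral ℚ t)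
    {d : ℕ} (hd : d = (minpoly ℚ t).natDegree) (q : Fin d → ℤ) (hq : q ≠ 0) :
    ∑ i, q i * (((minpoly ℚ t).map (algebraMap ℚ ℝ)) /ₘ (X - C t)).coeff i ≠ 0 := by
  set p := minpoly ℚ t with hp
  have hmon : p.Monic := minpoly.monic ht
  have hcoef : ∀ i : Fin d, ((p.map (algebraMap ℚ ℝ)) /ₘ (X - C t)).coeff i =
      ∑ n ∈ Finset.range d, t ^ n * (p.coeff (i + 1 + n) : ℝ) := fun i => by
    rw [coeff_divByMonic_X_sub_C, natDegree_map, ← hd, ← Finset.Ico_succ_right_eq_Icc,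
      Finset.sum_Ico_eq_sum_range]
    simp only [Nat.add_sub_cancel_left, coeff_map, eq_ratCast]
    refine Finset.sum_subset (Finset.range_mono (by simp)) fun n _ hn => ?_
    rw [coeff_eq_zero_of_natDegree_lt, Rat.cast_zero, mul_zero]
    simp only [Finset.mem_range, Nat.succ_eq_succ, Nat.succ_eq_add_one] at hn
    omega
  let P : ℚ[X] := ∑ i : Fin d, C (q i : ℚ) * ∑ n ∈ Finset.range d, C (p.coeff (i + 1 + n)) * X ^ n
  have hPt : aeval t P = ∑ i, q i * ((p.map (algebraMap ℚ ℝ)) /ₘ (X - C t)).coeff i := by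
    simp only [P, map_sum, map_mul, aeval_C, map_pow, aeval_X, hcoef, eq_ratCast]
    simp [mul_comm]
  have hPcoeff : ∀ k < d, P.coeff k = ∑ i : Fin d, q i * p.coeff (i + 1 + k) := fun k hk => by
    simp only [P, finsetSum_coeff, coeff_C_mul, coeff_X_pow]
    simp [hk]
  have hPdeg : P.degree < d := by
    rw [degree_lt_iff_coeff_zero]
    intro k hk
    simp only [P, finsetSum_coeff, coeff_C_mul, coeff_X_pow]
    refine Finset.sum_eq_zero fun i _ => ?_
    rw [Finset.sum_eq_zero, mul_zero]
    intro n hn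
    rw [if_neg (by have := Finset.mem_range.1 hn; omega), mul_zero]
  intro h0
  rw [← hPt] at h0
  have hP0 : P = 0 := by
    by_contra hne
    have := minpoly.degree_le_of_ne_zero ℚ t hne h0
    rw [← hp, degree_eq_natDegree hmon.ne_zero, ← hd] at this
    exact absurd hPdeg (not_lt.2 this)
  -- the coefficient at the least index of the support of `q`
  obtain ⟨i₀, hi₀, hmin⟩ : ∃ i₀, q i₀ ≠ 0 ∧ ∀ i < i₀, q i = 0 := by
    obtain ⟨j, hj⟩ := Function.ne_iff.1 hq
    have hne : (Finset.univ.filter fun i => q i ≠ 0).Nonempty := ⟨j, by simpa using hj⟩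
    refine ⟨_, (Finset.mem_filter.1 (Finset.min'_mem _ hne)).2, fun i hi => ?_⟩
    by_contra hqi
    exact absurd hi (not_lt.2 (Finset.min'_le _ _ (by simpa using hqi)))
  have hk := hPcoeff (d - 1 - i₀) (by have := i₀.2; omega)
  rw [hP0, coeff_zero, Finset.sum_eq_single i₀] at hk
  · have : (i₀ : ℕ) + 1 + (d - 1 - i₀) = d := by have := i₀.2; omega
    rw [this, hd, hmon.coeff_natDegree, mul_one] at hk
    exact hi₀ (by exact_mod_cast hk.symm)
  · intro i _ hne
    rcases lt_or_gt_of_ne hne with h | h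
    · simp [hmin i h]
    · rw [coeff_eq_zero_of_natDegree_lt, mul_zero]
      have h1 : (i₀ : ℕ) < i := h
      have := i.2
      omega
  · simp

theorem coeff_divByMonic_mem_adjoin {t : ℝ} (p : ℚ[X]) (i : ℕ) :
    ((p.map (algebraMap ℚ ℝ)) /ₘ (X - C t)).coeff i ∈ ℚ⟮t⟯ := by
  rw [coeff_divByMonic_X_sub_C]
  refine sum_mem fun j _ => mul_mem (pow_mem (IntermediateField.mem_adjoin_simple_self ℚ t) _) ?_
  rw [coeff_map]
  exact ℚ⟮t⟯.algebraMap_mem _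

theorem eval_divByMonic_minpoly_ne_zero {t : ℝ} (ht : IsIntegral ℚ t) :
    (((minpoly ℚ t).map (algebraMap ℚ ℝ)) /ₘ (X - C t)).eval t ≠ 0 := by
  have hroot : ((minpoly ℚ t).map (algebraMap ℚ ℝ)).IsRoot t := by
    rw [IsRoot, eval_map_algebraMap, minpoly.aeval]
  have hmul := mul_divByMonic_eq_iff_isRoot.2 hroot
  have hsep := (minpoly.irreducible ht).separable.aeval_derivative_ne_zero (minpoly.aeval ℚ t)
  rw [← eval_map_algebraMap, ← derivative_map, ← hmul, derivative_mul] at hsep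
  simpa using hsep

/-- The set of all `θᵐ x` with `x ∈ E` winds into a closed null set of the torus
`ℝ[X]/(f) / ℤ[X]/(f)`, where `f` is the minimal polynomial of `θ`, along the eigenline of
multiplication by `X`. -/
theorem IsPisot.exists_trigSum_near_one {θ α : ℝ} (hθ : IsPisot θ) (hθα : θ * α = 1) {l : ℕ}
    (hlθ : l < θ) {a : Fin l → ℝ} (ha : ∀ i, a i ∈ Algebra.adjoin ℤ ({θ} : Set ℝ)) {E : Set ℝ}
    (hE : IsCompact E) (hsub : E ⊆ ⋃ i, (fun x => α * x + a i) '' E) :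
    ∃ (ι : Type) (_ : Fintype ι) (s : ι → ℝ) (b : ι → ℂ) (c₀ : ℂ), ‖c₀‖ ≤ 1 / 2 ∧
      (∀ i, s i ≠ 0 ∧ s i ∈ ℚ⟮θ⟯) ∧ ∀ (m : ℕ), ∀ x ∈ E, ‖c₀ + (∑ i, b i * Complex.exp
        (2 * Real.pi * Complex.I * ((s i * (θ ^ m * x) : ℝ) : ℂ))) - 1‖ ≤ 1 / 4 := by
  classical
  obtain ⟨hint, hθ1, hconj⟩ := hθ
  have hintQ : IsIntegral ℚ θ := hint.tower_top
  have hα : 0 < α := pos_of_mul_pos_right (by rw [hθα]; exact one_pos) (by linarith)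
  have hE0 : volume E = 0 := volume_eq_zero_of_subset_iUnion_image hα (by nlinarith) a hE hsub
  set p := minpoly ℚ θ with hp
  set f := minpoly ℤ θ with hf
  have hfp : p = f.map (algebraMap ℤ ℚ) := minpoly.isIntegrallyClosed_eq_field_fractions' ℚ hint
  have hfmon : f.Monic := minpoly.monic hint
  have hpmon : p.Monic := minpoly.monic hintQ
  set d := p.natDegree with hd
  have hdf : f.natDegree = d := by rw [hd, hfp, hfmon.natDegree_map]
  have hd0 : 0 < d := minpoly.natDegree_pos hintQ
  set h : ℝ[X] := (p.map (algebraMap ℚ ℝ)) /ₘ (X - C θ) with hh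
  have hroot : (p.map (algebraMap ℚ ℝ)).IsRoot θ := by
    rw [IsRoot, eval_map_algebraMap, hp, minpoly.aeval]
  have hmul : (X - C θ) * h = p.map (algebraMap ℚ ℝ) := mul_divByMonic_eq_iff_isRoot.2 hroot
  have hhθ : h.eval θ ≠ 0 := eval_divByMonic_minpoly_ne_zero hintQ
  have hhdeg : h.natDegree < d := by
    rw [hh, natDegree_divByMonic _ (monic_X_sub_C θ), natDegree_map, natDegree_X_sub_C]
    omega
  -- the complex conjugates of `θ`
  let Z : Finset ℂ := (p.aroots ℂ).toFinset
  have hmemZ : ∀ z, z ∈ Z ↔ aeval z p = 0 := fun z => by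
    simp [Z, hpmon.ne_zero]
  have hZcard : Z.card = d := by
    have hsep : p.Separable := (minpoly.irreducible hintQ).separable
    rw [Multiset.toFinset_card_of_nodup (nodup_aroots_iff_of_splits hpmon.ne_zero
      (IsAlgClosed.splits _) |>.2 hsep), ← (IsAlgClosed.splits _).natDegree_eq_card_roots, natDegree_map]
  obtain ⟨C₁, hC₁⟩ := exists_blowup_eq_aeval_add hθα ha hsub (Z.erase (θ : ℂ)) (fun z hz => by
    rw [Finset.mem_erase, hmemZ] at hz
    exact hconj z hz.2 hz.1)
  obtain ⟨C₂, hC₂⟩ := hE.isBounded.exists_norm_le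
  obtain ⟨C₃, hC₃⟩ := exists_norm_coeff_le_of_card Z (max C₁ C₂)
  -- evaluation at `θ` in the coordinates of the power basis
  let L : (Fin d → ℝ) →ₗ[ℝ] ℝ := ∑ i : Fin d, θ ^ (i : ℕ) • LinearMap.proj i
  have hL : ∀ w, L w = ∑ i, w i * θ ^ (i : ℕ) := fun w => by simp [L, mul_comm]
  let K : Set (Fin d → ℝ) := Metric.closedBall 0 (max C₃ 0) ∩ L ⁻¹' E
  have hK : IsCompact K := (isCompact_closedBall _ _).inter_right
    (hE.isClosed.preimage L.continuous_of_finiteDimensional)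
  have hK0 : volume K = 0 := by
    have hsurj : Function.Surjective L := fun y => ⟨Pi.single ⟨0, hd0⟩ y, by
      rw [hL, Finset.sum_eq_single ⟨0, hd0⟩] <;> simp +contextual⟩
    obtain ⟨c, -, hc⟩ := L.exists_map_addHaar_eq_smul_addHaar volume volume hsurj
    refine measure_mono_null inter_subset_right ?_
    rw [← Measure.map_apply L.continuous_of_finiteDimensional.measurable hE.measurableSet, hc]
    simp [hE0]
  obtain ⟨c, hc0, hc⟩ := exists_trigPoly_near_one_of_null hK hK0
  let s : (Fin d → ℤ) → ℝ := fun q => ∑ i, q i * (h.coeff i / h.eval θ)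
  have hs : ∀ q, s q = (∑ i, q i * h.coeff i) / h.eval θ := fun q => by
    simp only [s, Finset.sum_div, mul_div_assoc]
  refine ⟨{q // q ∈ c.support.erase 0}, inferInstance, fun q => s q, fun q => c q, c 0, hc0,
    fun q => ⟨?_, ?_⟩, fun m x hx => ?_⟩
  · simp only [hs]
    exact div_ne_zero (sum_coeff_divByMonic_minpoly_ne_zero hintQ hd _ (Finset.mem_erase.1 q.2).1) hhθ
  · have hcm : ∀ i, h.coeff i ∈ ℚ⟮θ⟯ := fun i => coeff_divByMonic_mem_adjoin p i
    simp only [hs]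
    refine div_mem (sum_mem fun i _ => mul_mem (intCast_mem _ _) (hcm i)) ?_
    rw [eval_eq_sum_range]
    exact sum_mem fun i _ => mul_mem (hcm i)
      (pow_mem (IntermediateField.mem_adjoin_simple_self ℚ θ) _)
  · obtain ⟨G, x', hx', hG, hGC⟩ := hC₁ m x hx
    set y := θ ^ m * x with hy
    -- the point `y h / h(θ)` of the eigenline, translated by the lattice vector `G mod f`
    let r : ℤ[X] := G %ₘ f
    have hrdeg : r.degree < d := by
      rw [← hdf, ← degree_eq_natDegree hfmon.ne_zero]
      exact degree_modByMonic_lt _ hfmon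
    have hraeval : ∀ {A : Type} [CommRing A] [Algebra ℚ A] (z : A), aeval z p = 0 →
        aeval z r = aeval z G := fun z hz => by
      rw [hfp, aeval_map_algebraMap] at hz
      exact aeval_modByMonic_eq_self_of_root hz
    let w : ℝ[X] := C (y / h.eval θ) * h - r.map (Int.castRingHom ℝ)
    have hwdeg : w.degree < d := by
      refine (degree_sub_le _ _).trans_lt (max_lt ?_ ((degree_map_le).trans_lt hrdeg))
      exact degree_le_natDegree.trans_lt (by exact_mod_cast (natDegree_C_mul_le _ _).trans_lt hhdeg)
    have hwnat : w.natDegree < d := by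
      rcases eq_or_ne w 0 with h0 | h0
      · simpa [h0] using hd0
      · exact (natDegree_lt_iff_degree_lt h0).2 hwdeg
    have hwθ : w.eval θ = x' := by
      have h1 : (r.map (Int.castRingHom ℝ)).eval θ = aeval θ G := by
        rw [← hraeval θ (minpoly.aeval ℚ θ), ← eval_map_algebraMap]
        rfl
      simp only [w, eval_sub, eval_mul, eval_C, h1]
      rw [div_mul_cancel₀ _ hhθ, hG]
      ring
    have hwz : ∀ z ∈ Z, ‖(w.map (algebraMap ℝ ℂ)).eval z‖ ≤ max C₁ C₂ := fun z hz => by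
      by_cases hzθ : z = θ
      · subst hzθ
        have : (w.map (algebraMap ℝ ℂ)).eval (θ : ℂ) = ((w.eval θ : ℝ) : ℂ) := by
          rw [eval_map]; exact eval₂_at_apply (algebraMap ℝ ℂ) θ
        rw [this, hwθ, Complex.norm_real]
        exact (hC₂ x' hx').trans (le_max_right _ _)
      · have hz0 := (hmemZ z).1 hz
        have hhz : aeval z h = 0 := by
          have h1 := congrArg (aeval z) hmul
          rw [aeval_map_algebraMap, hz0, map_mul, mul_eq_zero] at h1
          refine h1.resolve_left ?_
          simpa [sub_eq_zero] using hzθ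
        have : (w.map (algebraMap ℝ ℂ)).eval z = - aeval z G := by
          rw [eval_map_algebraMap, ← hraeval z hz0]
          simp only [w, map_sub, map_mul, hhz, mul_zero, zero_sub]
          congr 1
          exact aeval_map_algebraMap ℝ z r
        rw [this, norm_neg]
        exact (hGC z (Finset.mem_erase.2 ⟨hzθ, hz⟩)).trans (le_max_left _ _)
    have hcoef : ∀ i, |w.coeff i| ≤ C₃ := fun i => by
      have := hC₃ (w.map (algebraMap ℝ ℂ)) (degree_map_le.trans_lt (by rwa [hZcard])) hwz i
      simpa using this
    have hmem : (fun i : Fin d => y * (h.coeff i / h.eval θ) + ((-r.coeff i : ℤ) : ℝ)) ∈ K := by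
      have hwi : (fun i : Fin d => y * (h.coeff i / h.eval θ) + ((-r.coeff i : ℤ) : ℝ)) =
          fun i : Fin d => w.coeff i := by
        ext i
        simp only [w, coeff_sub, coeff_C_mul, coeff_map, eq_intCast]
        push_cast
        ring
      rw [hwi]
      refine ⟨?_, ?_⟩
      · rw [mem_closedBall_zero_iff, pi_norm_le_iff_of_nonneg (le_max_right _ _)]
        exact fun i => (hcoef i).trans (le_max_left _ _)
      · rw [mem_preimage, hL, Fin.sum_univ_eq_sum_range (fun i => w.coeff i * θ ^ i),
          ← eval_eq_sum_range' hwnat, hwθ]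
        exact hx'
    have hfin := hc _ _ hmem
    have hsq : ∀ q : Fin d → ℤ, ∑ i, (q i : ℝ) * (y * (h.coeff i / h.eval θ)) = s q * y := fun q => by
      simp only [s, Finset.sum_mul]
      exact Finset.sum_congr rfl fun i _ => by ring
    simp only [hsq, Finsupp.sum] at hfin
    convert hfin using 3
    rw [Finset.sum_coe_sort (c.support.erase 0) (fun q => c q * Complex.exp
      (2 * Real.pi * Complex.I * ((s q * y : ℝ) : ℂ)))]
    have hs0 : s 0 = 0 := by simp [s]
    by_cases h0 : (0 : Fin d → ℤ) ∈ c.support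
    · rw [← Finset.add_sum_erase _ _ h0, hs0]
      simp
    · rw [Finset.erase_eq_of_notMem h0, Finsupp.notMem_support_iff.1 h0, zero_add]

/-- The frequencies and the lower bound for the Riesz products serve all cubes in `E` and all of their
blow-ups by powers of `θ`. -/
theorem IsPisot.exists_frequencies {θ α : ℝ} (hθ : IsPisot θ) (hθα : θ * α = 1) {l : ℕ}
    (hlθ : l < θ) {a : Fin l → ℝ} (ha : ∀ i, a i ∈ Algebra.adjoin ℤ ({θ} : Set ℝ)) {E : Set ℝ}
    (hE : IsCompact E) (hsub : E ⊆ ⋃ i, (fun x => α * x + a i) '' E) :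
    ∃ (S : Finset ℝ) (η : ℝ), 0 < η ∧ (∀ s ∈ S, s ≠ 0 ∧ s ∈ ℚ⟮θ⟯) ∧
      ∀ (m n : ℕ) (u : ℝ) (x : ℕ → ℝ), (∀ ε : ℕ → ℝ, (∀ k, ε k = 0 ∨ ε k = 1) →
        u + ∑ k ∈ Finset.range n, ε k * x k ∈ E) →
      ∃ s ∈ S, η ≤ ∏ k ∈ Finset.range n, |Real.cos (Real.pi * (s * (θ ^ m * x k)))| := by
  classical
  obtain ⟨ι, _, s, b, c₀, hc₀, hs, hsum⟩ := hθ.exists_trigSum_near_one hθα hlθ ha hE hsub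
  refine ⟨Finset.univ.image s, 1 / (4 * (∑ i, ‖b i‖ + 1)), ?_, by simpa using hs, ?_⟩
  · have : 0 ≤ ∑ i, ‖b i‖ := Finset.sum_nonneg fun i _ => norm_nonneg _
    positivity
  intro m n u x hx
  obtain ⟨i, hi⟩ := exists_prod_cos_ge s c₀ hc₀ b n (fun k => θ ^ m * x k) (θ ^ m * u)
    fun ε hε => by
      have := hsum m _ (hx ε hε)
      rw [mul_add, Finset.mul_sum] at this
      simpa only [mul_left_comm] using this
  exact ⟨s i, by simp, hi⟩

open Filter Topology

/-! ### Powers close to integers, and choice of a dilation -/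

theorem eventually_eq_zero_of_tendsto_int {v : ℕ → ℝ} (hv : Tendsto v atTop (𝓝 0))
    (hint : ∀ j, ∃ k : ℤ, v j = k) : ∀ᶠ j in atTop, v j = 0 := by
  filter_upwards [hv (Metric.ball_mem_nhds 0 one_pos)] with j hj
  obtain ⟨k, hk⟩ := hint j
  have hj' : |v j| < 1 := by simpa [Real.dist_eq] using hj
  rw [hk] at hj' ⊢
  have : |k| < 1 := by exact_mod_cast hj'
  rw [Int.abs_lt_one_iff.1 this, Int.cast_zero]

/-- The algebraic case of Pisot's theorem on numbers `t κʲ` close to integers. The defects, filtered by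
the coefficients of `f / (X - κ)` with `f` the minimal polynomial of `κ`, eventually form a geometric
progression of ratio `κ` that tends to `0`, hence vanish. -/
theorem mem_adjoin_of_tendsto_sub_int {κ t : ℝ} (hκ : IsIntegral ℤ κ) (hκ1 : 1 < κ) (k : ℕ → ℤ)
    (hk : Tendsto (fun j => t * κ ^ j - k j) atTop (𝓝 0)) : t ∈ ℚ⟮κ⟯ := by
  have hκQ : IsIntegral ℚ κ := hκ.tower_top
  set p := minpoly ℚ κ with hp
  set f := minpoly ℤ κ with hf
  have hfp : p = f.map (algebraMap ℤ ℚ) := minpoly.isIntegrallyClosed_eq_field_fractions' ℚ hκ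
  set d := p.natDegree with hd
  have hd0 : 0 < d := minpoly.natDegree_pos hκQ
  set h : ℝ[X] := (p.map (algebraMap ℚ ℝ)) /ₘ (X - C κ) with hh
  have hroot : (p.map (algebraMap ℚ ℝ)).IsRoot κ := by
    rw [IsRoot, eval_map_algebraMap, hp, minpoly.aeval]
  have hmul : (X - C κ) * h = p.map (algebraMap ℚ ℝ) := mul_divByMonic_eq_iff_isRoot.2 hroot
  have hhκ : h.eval κ ≠ 0 := eval_divByMonic_minpoly_ne_zero hκQ
  have hhdeg : h.natDegree < d := by
    rw [hh, natDegree_divByMonic _ (monic_X_sub_C κ), natDegree_map, natDegree_X_sub_C]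
    omega
  have hcm : ∀ i, h.coeff i ∈ ℚ⟮κ⟯ := fun i => coeff_divByMonic_mem_adjoin p i
  have hpc : ∀ i, ((p.map (algebraMap ℚ ℝ)).coeff i) = (f.coeff i : ℝ) := fun i => by
    rw [hfp, Polynomial.map_map, coeff_map]; simp
  have hf0 : (f.coeff 0 : ℝ) = -κ * h.coeff 0 := by
    rw [← hpc, ← hmul, mul_coeff_zero]; simp
  have hfs : ∀ i, (f.coeff (i + 1) : ℝ) = h.coeff i - κ * h.coeff (i + 1) := fun i => by
    rw [← hpc, ← hmul, sub_mul, coeff_sub, coeff_X_mul, coeff_C_mul]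
  have hfκ : ∑ i ∈ Finset.range (d + 1), (f.coeff i : ℝ) * κ ^ i = 0 := by
    simp only [← hpc]
    rw [← eval_eq_sum_range' (by rw [natDegree_map]; omega)]
    exact hroot
  have hhsum : ∑ i ∈ Finset.range (d + 1), h.coeff i * κ ^ i = h.eval κ :=
    (eval_eq_sum_range' (by omega) κ).symm
  set δ : ℕ → ℝ := fun j => t * κ ^ j - k j with hδ
  let D : ℕ → ℝ := fun j => ∑ i ∈ Finset.range (d + 1), h.coeff i * δ (j + i)
  let R : ℕ → ℝ := fun j => ∑ i ∈ Finset.range (d + 1), (f.coeff i : ℝ) * δ (j + i)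
  have hshift : ∀ i, Tendsto (fun j => δ (j + i)) atTop (𝓝 0) := fun i =>
    hk.comp (tendsto_add_atTop_nat i)
  have hD : Tendsto D atTop (𝓝 0) := by
    simpa using tendsto_finsetSum (Finset.range (d + 1)) fun i _ => (hshift i).const_mul (h.coeff i)
  have hR : Tendsto R atTop (𝓝 0) := by
    simpa using tendsto_finsetSum (Finset.range (d + 1))
      fun i _ => (hshift i).const_mul (f.coeff i : ℝ)
  have hsplit : ∀ (c : ℕ → ℝ) (j : ℕ), ∑ i ∈ Finset.range (d + 1), c i * δ (j + i) =
      t * κ ^ j * (∑ i ∈ Finset.range (d + 1), c i * κ ^ i) -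
        ∑ i ∈ Finset.range (d + 1), c i * k (j + i) := fun c j => by
    rw [Finset.mul_sum, ← Finset.sum_sub_distrib]
    refine Finset.sum_congr rfl fun i _ => ?_
    simp only [hδ, pow_add]
    ring
  have hRint : ∀ j, ∃ n : ℤ, R j = n := fun j => by
    refine ⟨-∑ i ∈ Finset.range (d + 1), f.coeff i * k (j + i), ?_⟩
    simp only [R]
    rw [hsplit, hfκ]
    push_cast
    ring
  have hrec : ∀ j, D (j + 1) = κ * D j + R j := fun j => by
    have h1 : D (j + 1) = ∑ i ∈ Finset.range d, h.coeff i * δ (j + (i + 1)) := by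
      simp only [D]
      rw [Finset.sum_range_succ, coeff_eq_zero_of_natDegree_lt hhdeg, zero_mul, add_zero]
      exact Finset.sum_congr rfl fun i _ => by rw [add_right_comm, add_assoc]
    rw [h1]
    simp only [D, R]
    rw [Finset.sum_range_succ', Finset.sum_range_succ', hf0, mul_add, Finset.mul_sum]
    have : ∀ A B₁ B₂ A₂ : ℝ, A = B₁ + A₂ → A = B₁ + κ * B₂ + (A₂ + -κ * B₂) := fun _ _ _ _ h => by
      rw [h]; ring
    rw [mul_assoc (-κ)]
    refine this _ _ _ _ ?_
    rw [← Finset.sum_add_distrib]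
    refine Finset.sum_congr rfl fun i _ => ?_
    rw [hfs]
    ring
  obtain ⟨J, hJ⟩ := eventually_atTop.1 (eventually_eq_zero_of_tendsto_int hR hRint)
  have hgeom : ∀ n, D (J + n) = κ ^ n * D J := fun n => by
    induction n with
    | zero => simp
    | succ n ih => rw [← add_assoc, hrec, ih, hJ _ (by omega)]; ring
  have hDJ : D J = 0 := by
    by_contra hne
    have h1 : Tendsto (fun n => D (J + n)) atTop (𝓝 0) := by
      simpa [Function.comp_def, add_comm] using hD.comp (tendsto_add_atTop_nat J)
    have h2 : ∀ n, |D J| ≤ |D (J + n)| := fun n => by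
      rw [hgeom, abs_mul, abs_of_pos (pow_pos (one_pos.trans hκ1) n)]
      exact le_mul_of_one_le_left (abs_nonneg _) (one_le_pow₀ hκ1.le)
    have h4 := ge_of_tendsto' h1.abs h2
    rw [abs_zero] at h4
    exact hne (abs_nonpos_iff.1 h4)
  have hfin := hsplit h.coeff J
  rw [show ∑ i ∈ Finset.range (d + 1), h.coeff i * δ (J + i) = 0 from hDJ, hhsum] at hfin
  have hκm : κ ∈ ℚ⟮κ⟯ := IntermediateField.mem_adjoin_simple_self ℚ κ
  have ht : t = (∑ i ∈ Finset.range (d + 1), h.coeff i * k (J + i)) / (κ ^ J * h.eval κ) := by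
    rw [eq_div_iff (mul_ne_zero (pow_ne_zero _ (by linarith)) hhκ)]
    linarith
  rw [ht]
  refine div_mem (sum_mem fun i _ => mul_mem (hcm i) (intCast_mem _ _)) (mul_mem (pow_mem hκm _) ?_)
  rw [eval_eq_sum_range]
  exact sum_mem fun i _ => mul_mem (hcm i) (pow_mem hκm _)

/-- A Riesz product bounded away from `0` has frequencies approaching the integers. -/
theorem exists_tendsto_sub_int_of_prod_cos_ge {x : ℕ → ℝ} {η : ℝ} (hη : 0 < η)
    (h : ∀ n, η ≤ ∏ k ∈ Finset.range n, |Real.cos (Real.pi * x k)|) :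
    ∃ k : ℕ → ℤ, Tendsto (fun j => x j - k j) atTop (𝓝 0) := by
  let P : ℕ → ℝ := fun n => ∏ k ∈ Finset.range n, |Real.cos (Real.pi * x k)|
  have hPs : ∀ n, P (n + 1) = P n * |Real.cos (Real.pi * x n)| := fun n => Finset.prod_range_succ _ _
  have hPpos : ∀ n, 0 < P n := fun n => hη.trans_le (h n)
  have hanti : Antitone P := antitone_nat_of_succ_le fun n => by
    rw [hPs]
    exact mul_le_of_le_one_right (hPpos n).le (Real.abs_cos_le_one _)
  have hlim := tendsto_atTop_ciInf hanti ⟨η, by rintro _ ⟨n, rfl⟩; exact h n⟩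
  set L := ⨅ n, P n
  have hL : 0 < L := hη.trans_le (ge_of_tendsto' hlim h)
  have hcos : Tendsto (fun n => |Real.cos (Real.pi * x n)|) atTop (𝓝 1) := by
    have := (hlim.comp (tendsto_add_atTop_nat 1)).div hlim hL.ne'
    rw [div_self hL.ne'] at this
    refine this.congr fun n => ?_
    simp only [Function.comp_apply, Pi.div_apply, hPs]
    rw [mul_div_cancel_left₀ _ (hPpos n).ne']
  have hsin : Tendsto (fun n => |Real.sin (Real.pi * x n)| / 2) atTop (𝓝 0) := by
    have h1 : Tendsto (fun n => √(1 - |Real.cos (Real.pi * x n)| ^ 2) / 2) atTop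
        (𝓝 (√(1 - 1 ^ 2) / 2)) := ((hcos.pow 2).const_sub 1).sqrt.div_const 2
    simp only [one_pow, sub_self, Real.sqrt_zero, zero_div] at h1
    refine h1.congr fun n => ?_
    rw [sq_abs, ← Real.abs_sin_eq_sqrt_one_sub_cos_sq]
  refine ⟨fun n => round (x n), squeeze_zero_norm (fun n => ?_) hsin⟩
  set y := x n - round (x n) with hy
  have hy2 : |y| ≤ 1 / 2 := abs_sub_round (x n)
  have hsy : |Real.sin (Real.pi * x n)| = |Real.sin (Real.pi * y)| := by
    rw [hy, mul_sub, mul_comm Real.pi (round (x n) : ℝ), Real.sin_sub_int_mul_pi, abs_mul]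
    simp
  have hpi := Real.pi_pos
  have h2 : Real.sin (Real.pi * |y|) = |Real.sin (Real.pi * y)| := by
    have : Real.pi * |y| = |Real.pi * y| := by rw [abs_mul, abs_of_pos hpi]
    rw [this, ← Real.abs_sin_eq_sin_abs_of_abs_le_pi]
    rw [← this]
    nlinarith
  have h3 := Real.mul_le_sin (x := Real.pi * |y|) (by positivity) (by nlinarith)
  rw [h2, ← hsy, ← mul_assoc, div_mul_cancel₀ _ hpi.ne'] at h3
  rw [Real.norm_eq_abs]
  linarith

theorem exists_nat_mul_sub_nat_mul_mem {x y : ℝ} (hx : 0 < x) (hy : 0 < y) (hxy : Irrational (x / y))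
    {U : Set ℝ} (hU : IsOpen U) (hne : U.Nonempty) (N : ℕ) :
    ∃ m n : ℕ, N ≤ n ∧ m * y - n * x ∈ U := by
  have : Fact (0 < y) := ⟨hy⟩
  obtain ⟨t, ht⟩ := hne
  let V : Set ℝ := U ∩ Ioo (t - 1) (t + 1)
  have hV : IsOpen V := hU.inter isOpen_Ioo
  have hdense : DenseRange (· • ((-x : ℝ) : AddCircle y) : ℤ → AddCircle y) := by
    rw [AddCircle.denseRange_zsmul_coe_iff, neg_div]
    exact hxy.neg
  have hcl := ((mapClusterPt_atTop_nsmul_tfae (t : AddCircle y) ((-x : ℝ) : AddCircle y)).out 3 0).1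
    (hdense _)
  have hfreq := hcl.frequently ((QuotientAddGroup.isOpenMap_coe V hV).mem_nhds
    ⟨t, ⟨ht, by simp⟩, rfl⟩)
  obtain ⟨n, ⟨t', ⟨ht'U, ht'⟩, hn⟩, hnN⟩ := (hfreq.and_eventually
    (eventually_ge_atTop (max N ⌈(1 - t) / x⌉₊))).exists
  have hnN1 : N ≤ n := (le_max_left _ _).trans hnN
  have hnx : (1 - t) / x ≤ n := (Nat.le_ceil _).trans (by exact_mod_cast (le_max_right _ _).trans hnN)
  rw [div_le_iff₀ hx] at hnx
  rw [← AddCircle.coe_nsmul] at hn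
  obtain ⟨m, hm⟩ := AddSubgroup.mem_zmultiples_iff.1 (QuotientAddGroup.eq_iff_sub_mem.1 hn)
  simp only [nsmul_eq_mul, zsmul_eq_mul] at hm
  have hmpos : 0 < (m : ℝ) * y := by linarith [ht'.1]
  have hm0 : 0 < m := by exact_mod_cast pos_of_mul_pos_left hmpos hy.le
  lift m to ℕ using hm0.le
  refine ⟨m, n, hnN1, ?_⟩
  have : (m : ℝ) * y - n * x = t' := by push_cast at hm; linarith
  rwa [this]

/-- By successive refinement, with a separate exponent for each frequency, some open set of dilations
makes all the Riesz products small at once. -/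
theorem exists_open_forall_exists_cos_lt {ω η : ℝ} (hω : 1 < ω) (hη : 0 < η) (S : Finset ℝ)
    (hS : ∀ s ∈ S, s ≠ 0) {U : Set ℝ} (hU : IsOpen U) (hne : U.Nonempty) :
    ∃ V ⊆ U, IsOpen V ∧ V.Nonempty ∧ ∃ N : ℕ, ∀ x ∈ V, ∀ s ∈ S, ∃ k < N,
      |Real.cos (Real.pi * (s * (x * ω ^ k)))| < η := by
  classical
  induction S using Finset.induction_on with
  | empty => exact ⟨U, subset_rfl, hU, hne, 0, by simp⟩
  | insert s S _ ih =>
    obtain ⟨V, hVU, hV, ⟨x₀, hx₀⟩, N, hN⟩ := ih fun s hs => hS s (Finset.mem_insert_of_mem hs)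
    obtain ⟨r, hr, hball⟩ := Metric.isOpen_iff.1 hV x₀ hx₀
    have hs0 : s ≠ 0 := hS s (Finset.mem_insert_self _ _)
    obtain ⟨k, hk⟩ := pow_unbounded_of_one_lt (1 / (|s| * r)) hω
    have hωk : 0 < ω ^ k := pow_pos (by linarith) k
    -- a zero of `x ↦ cos (π s x ωᵏ)` in the ball: consecutive zeros are `1 / (|s| ωᵏ) < r` apart
    let n : ℤ := round (s * (x₀ * ω ^ k) - 1 / 2)
    let x₁ : ℝ := (n + 1 / 2) / (s * ω ^ k)
    have hx₁ : s * (x₁ * ω ^ k) = n + 1 / 2 := by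
      simp only [x₁]
      field_simp
    have hx₁V : x₁ ∈ V := by
      apply hball
      rw [Metric.mem_ball, Real.dist_eq]
      have h1 : |s| * ω ^ k * |x₁ - x₀| ≤ 1 / 2 := by
        have h2 := abs_sub_round (s * (x₀ * ω ^ k) - 1 / 2)
        rw [abs_sub_comm] at h2
        have h3 : (n : ℝ) - (s * (x₀ * ω ^ k) - 1 / 2) = s * ω ^ k * (x₁ - x₀) := by
          linear_combination -hx₁
        rw [show (round (s * (x₀ * ω ^ k) - 1 / 2) : ℝ) = (n : ℝ) from rfl, h3, abs_mul, abs_mul,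
          abs_of_pos hωk] at h2
        exact h2
      have hs : 0 < |s| := abs_pos.2 hs0
      rw [div_lt_iff₀ (by positivity)] at hk
      by_contra! hge
      have := mul_le_mul_of_nonneg_left hge (by positivity : 0 ≤ |s| * ω ^ k)
      nlinarith
    have hcos : Real.cos (Real.pi * (s * (x₁ * ω ^ k))) = 0 := by
      rw [hx₁, Real.cos_eq_zero_iff]
      exact ⟨n, by ring⟩
    refine ⟨V ∩ {x | |Real.cos (Real.pi * (s * (x * ω ^ k)))| < η},
      inter_subset_left.trans hVU, hV.inter (isOpen_lt (by fun_prop) continuous_const),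
      ⟨x₁, hx₁V, by simpa [hcos] using hη⟩, max N (k + 1), fun x hx s' hs' => ?_⟩
    rcases Finset.mem_insert.1 hs' with rfl | hs'
    · exact ⟨k, by simp, hx.2⟩
    · obtain ⟨k', hk', hlt⟩ := hN x hx.1 s' hs'
      exact ⟨k', lt_max_of_lt_left hk', hlt⟩

/-! ### Arithmetic of the ratio of a geometric progression of cubes -/

theorem prod_range_abs_cos_antitone (x : ℕ → ℝ) :
    Antitone fun n => ∏ k ∈ Finset.range n, |Real.cos (Real.pi * x k)| :=
  antitone_nat_of_succ_le fun n => by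
    rw [Finset.prod_range_succ]
    exact mul_le_of_le_one_right (Finset.prod_nonneg fun _ _ => abs_nonneg _)
      (Real.abs_cos_le_one _)

theorem prod_range_abs_cos_le (x : ℕ → ℝ) {n k : ℕ} (hk : k < n) :
    ∏ k ∈ Finset.range n, |Real.cos (Real.pi * x k)| ≤ |Real.cos (Real.pi * x k)| := by
  rw [← Finset.mul_prod_erase _ _ (Finset.mem_range.2 hk)]
  exact mul_le_of_le_one_right (abs_nonneg _)
    (Finset.prod_le_one (fun _ _ => abs_nonneg _) fun _ _ => Real.abs_cos_le_one _)

theorem abs_cos_pi_mul_abs (y : ℝ) : |Real.cos (Real.pi * |y|)| = |Real.cos (Real.pi * y)| := by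
  rcases abs_choice y with h | h <;> simp [h]

/-- The cubes spanned by a geometric progression of ratio `γ` can be blown up by every power of `θ`.
If `|γ|` and `θ` were multiplicatively independent, the blown-up progressions would approximate all
dilates of a fixed progression, including one whose Riesz products are all small. -/
theorem rational_log_div_log_of_prod_cos_ge {θ γ D η : ℝ} (hθ : 1 < θ) (hγ0 : γ ≠ 0) (hγ1 : |γ| < 1)
    (hD : D ≠ 0) (hη : 0 < η) {S : Finset ℝ} (hS : ∀ s ∈ S, s ≠ 0)
    (h : ∀ m n : ℕ, ∃ s ∈ S,
      η ≤ ∏ k ∈ Finset.range n, |Real.cos (Real.pi * (s * (θ ^ m * (D * γ ^ k))))|) :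
    ∃ q : ℚ, Real.log |γ|⁻¹ / Real.log θ = q := by
  by_contra hirr
  have hirr' : Irrational (Real.log |γ|⁻¹ / Real.log θ) := fun ⟨q, hq⟩ => hirr ⟨q, hq.symm⟩
  have hγpos : 0 < |γ| := abs_pos.2 hγ0
  have hDpos : 0 < |D| := abs_pos.2 hD
  have hω : 1 < |γ|⁻¹ := (one_lt_inv₀ hγpos).2 hγ1
  obtain ⟨V, hV0, hV, ⟨v, hv⟩, N, hN⟩ :=
    exists_open_forall_exists_cos_lt hω hη S hS isOpen_Ioi (nonempty_Ioi (a := (0 : ℝ)))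
  obtain ⟨m, n, hn, hmem⟩ := exists_nat_mul_sub_nat_mul_mem (Real.log_pos hω) (Real.log_pos hθ) hirr'
    (U := {r | Real.exp r * |D| ∈ V}) (hV.preimage (by fun_prop))
    ⟨Real.log (v / |D|), by
      have : 0 < v := hV0 hv
      simp only [mem_ofPred_eq]
      rwa [Real.exp_log (by positivity), div_mul_cancel₀ _ hDpos.ne']⟩ N
  have hexp : Real.exp (m * Real.log θ - n * Real.log |γ|⁻¹) = θ ^ m * |γ| ^ n := by
    rw [Real.log_inv, mul_neg, sub_neg_eq_add, Real.exp_add, mul_comm (m : ℝ), mul_comm (n : ℝ),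
      Real.exp_mul, Real.exp_mul, Real.exp_log (by linarith), Real.exp_log hγpos,
      Real.rpow_natCast, Real.rpow_natCast]
  rw [mem_ofPred_eq, hexp] at hmem
  obtain ⟨s, hs, hge⟩ := h m (n + 1)
  obtain ⟨k, hk, hlt⟩ := hN _ hmem s hs
  have hle := prod_range_abs_cos_le (fun k => s * (θ ^ m * (D * γ ^ k)))
    (show n - k < n + 1 by omega)
  have heq : |s * (θ ^ m * (D * γ ^ (n - k)))| =
      |s * (θ ^ m * |γ| ^ n * |D| * |γ|⁻¹ ^ k)| := by
    have hpow : |γ| ^ n = |γ| ^ (n - k) * |γ| ^ k := by rw [← pow_add]; congr 1; omega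
    simp only [abs_mul, abs_pow, abs_abs, abs_inv, hpow]
    have : |γ| ^ k * |γ|⁻¹ ^ k = 1 := by rw [← mul_pow, mul_inv_cancel₀ hγpos.ne', one_pow]
    linear_combination (-|s| * |θ| ^ m * |γ| ^ (n - k) * |D|) * this
  rw [← abs_cos_pi_mul_abs, heq, abs_cos_pi_mul_abs] at hle
  linarith

/-- If `γ` and `θ` are multiplicatively dependent, the blown-up progressions include
`D γ⁻ⁱ` for `i ≤ n`, for every `n`, so that `s D γ⁻ⁱ` approaches the integers for one of the
frequencies `s`; along two residue classes of `i` the powers are powers of `θ`. -/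
theorem mem_adjoin_of_prod_cos_ge {θ γ D η : ℝ} (hθint : IsIntegral ℤ θ) (hθ : 1 < θ) (hγ0 : γ ≠ 0)
    (hD : D ≠ 0) (hη : 0 < η) {S : Finset ℝ} (hS : ∀ s ∈ S, s ≠ 0 ∧ s ∈ ℚ⟮θ⟯)
    (h : ∀ m n : ℕ, ∃ s ∈ S,
      η ≤ ∏ k ∈ Finset.range n, |Real.cos (Real.pi * (s * (θ ^ m * (D * γ ^ k))))|)
    {Q R : ℕ} (hQ : 0 < Q) (hR : 0 < R) (hQR : γ⁻¹ ^ Q = θ ^ R) : γ ∈ ℚ⟮θ⟯ := by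
  obtain ⟨s, hsS, hs⟩ : ∃ s ∈ S, ∀ n, η ≤ ∏ i ∈ Finset.range n,
      |Real.cos (Real.pi * (s * D * γ⁻¹ ^ i))| := by
    by_contra! hcon
    choose! n hn using hcon
    obtain ⟨s, hs, hge⟩ := h (R * S.sup n) (Q * S.sup n + 1)
    have hsn : n s ≤ Q * S.sup n + 1 :=
      (Finset.le_sup hs).trans ((Nat.le_mul_of_pos_left _ hQ).trans (Nat.le_succ _))
    have hanti := prod_range_abs_cos_antitone (fun i => s * D * γ⁻¹ ^ i) hsn
    refine absurd (hge.trans (le_of_eq ?_)) (not_le.2 (hanti.trans_lt (hn s hs)))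
    rw [← Finset.prod_range_reflect]
    refine Finset.prod_congr rfl fun i hi => ?_
    have hi' : i ≤ Q * S.sup n := Nat.lt_succ_iff.1 (Finset.mem_range.1 hi)
    have hpow : γ⁻¹ ^ (Q * S.sup n) = γ⁻¹ ^ (Q * S.sup n - i) * γ⁻¹ ^ i := by
      rw [← pow_add, Nat.sub_add_cancel hi']
    have hone : γ⁻¹ ^ (Q * S.sup n - i) * γ ^ (Q * S.sup n - i) = 1 := by
      rw [← mul_pow, inv_mul_cancel₀ hγ0, one_pow]
    rw [pow_mul, ← hQR, ← pow_mul, hpow, Nat.add_sub_cancel]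
    congr 3
    linear_combination (s * D * γ⁻¹ ^ i) * hone
  obtain ⟨k, hk⟩ := exists_tendsto_sub_int_of_prod_cos_ge hη hs
  obtain ⟨hs0, hsm⟩ := hS s hsS
  have hκ1 : 1 < θ ^ R := one_lt_pow₀ hθ hR.ne'
  have hle : ℚ⟮θ ^ R⟯ ≤ ℚ⟮θ⟯ := IntermediateField.adjoin_simple_le_iff.2
    (pow_mem (IntermediateField.mem_adjoin_simple_self ℚ θ) R)
  have hclass : ∀ r : ℕ, s * D * γ⁻¹ ^ r ∈ ℚ⟮θ⟯ := fun r => by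
    refine hle (mem_adjoin_of_tendsto_sub_int (hθint.pow R) hκ1 (fun j => k (Q * j + r)) ?_)
    have hlim : Tendsto (fun j : ℕ => Q * j + r) atTop atTop :=
      tendsto_atTop_mono (fun j => (Nat.le_mul_of_pos_left j hQ).trans (Nat.le_add_right _ _))
        tendsto_id
    refine (hk.comp hlim).congr fun j => ?_
    simp only [Function.comp_apply]
    rw [pow_add, pow_mul, hQR]
    ring
  have h0 : s * D ∈ ℚ⟮θ⟯ := by simpa using hclass 0
  have h1 : s * D * γ⁻¹ ∈ ℚ⟮θ⟯ := by simpa using hclass 1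
  have : γ = s * D / (s * D * γ⁻¹) := by field_simp
  rw [this]
  exact div_mem h0 h1

/-! ### Pisot numbers multiplicatively dependent on a given one -/

theorem exists_pow_eq_pow_of_log_div_log_eq {x y : ℝ} (hx : 1 < x) (hy : 1 < y) {q : ℚ}
    (hq : Real.log x / Real.log y = q) : ∃ Q R : ℕ, 0 < Q ∧ 0 < R ∧ x ^ Q = y ^ R := by
  have hlx := Real.log_pos hx
  have hly := Real.log_pos hy
  have hq0 : 0 < q := by
    have : (0 : ℝ) < q := by rw [← hq]; positivity
    exact_mod_cast this
  have hnum : 0 < q.num := Rat.num_pos.2 hq0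
  refine ⟨q.den, q.num.toNat, q.den_pos, by omega, ?_⟩
  refine Real.log_injOn_pos (mem_Ioi.2 (by positivity)) (mem_Ioi.2 (by positivity)) ?_
  rw [Real.log_pow, Real.log_pow]
  have h1 : ((q.num.toNat : ℕ) : ℝ) = (q.num : ℝ) := by
    exact_mod_cast Int.toNat_of_nonneg hnum.le
  have h2 : (q : ℝ) = q.num / q.den := by exact_mod_cast (Rat.num_div_den q).symm
  have hden : (q.den : ℝ) ≠ 0 := by exact_mod_cast q.den_nz
  rw [h1]
  rw [h2, div_eq_div_iff hly.ne' hden] at hq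
  linarith

/-- A real number `w > 1` in the field of a Pisot number `θ` that is multiplicatively dependent on
`θ` is a Pisot number: an embedding of `ℚ(θ)` that moves `w` moves `θ`. -/
theorem IsPisot.of_pow_eq_pow {θ w : ℝ} (hθ : IsPisot θ) (hw : 1 < w) (hmem : w ∈ ℚ⟮θ⟯) {Q R : ℕ}
    (hQ : 0 < Q) (hR : 0 < R) (hQR : w ^ Q = θ ^ R) : IsPisot w := by
  obtain ⟨hint, hθ1, hconj⟩ := hθ
  refine ⟨IsIntegral.of_pow hQ (by rw [hQR]; exact hint.pow R), hw, fun z hz hzw => ?_⟩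
  have hintQ : IsIntegral ℚ θ := hint.tower_top
  have : Algebra.IsAlgebraic ℚ ℚ⟮θ⟯ := IntermediateField.isAlgebraic_adjoin_simple hintQ
  let w' : ℚ⟮θ⟯ := ⟨w, hmem⟩
  have hmin : minpoly ℚ w' = minpoly ℚ w :=
    (minpoly.algebraMap_eq (algebraMap ℚ⟮θ⟯ ℝ).injective w').symm
  have hzr : z ∈ (minpoly ℚ w').rootSet ℂ := by
    rw [mem_rootSet]
    refine ⟨minpoly.ne_zero (Algebra.IsIntegral.isIntegral w'), ?_⟩
    rwa [hmin]
  rw [← Algebra.IsAlgebraic.range_eval_eq_rootSet_minpoly ℂ w'] at hzr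
  obtain ⟨σ, hσ⟩ := hzr
  simp only at hσ
  let g := IntermediateField.AdjoinSimple.gen ℚ θ
  have hpow : w' ^ Q = g ^ R := Subtype.ext (by simpa [w', g] using hQR)
  have hroot : aeval (σ g) (minpoly ℚ θ) = 0 := by
    have h1 : minpoly ℚ g = minpoly ℚ θ := IntermediateField.minpoly_gen ℚ θ
    rw [aeval_algHom_apply, ← h1, minpoly.aeval, map_zero]
  have hne : σ g ≠ (θ : ℂ) := fun heq => by
    let τ : ℚ⟮θ⟯ →ₐ[ℚ] ℂ := (Complex.ofRealAm.restrictScalars ℚ).comp ℚ⟮θ⟯.val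
    have hστ : σ = τ := by
      refine (IntermediateField.adjoin.powerBasis hintQ).algHom_ext ?_
      rw [IntermediateField.adjoin.powerBasis_gen]
      exact heq
    exact hzw (by rw [← hσ, hστ]; rfl)
  have hlt := hconj _ hroot hne
  have hzpow : z ^ Q = σ g ^ R := by rw [← hσ, ← map_pow, hpow, map_pow]
  by_contra! hge
  have h1 : 1 ≤ ‖z ^ Q‖ := by rw [norm_pow]; exact one_le_pow₀ hge
  rw [hzpow, norm_pow] at h1
  exact absurd h1 (not_le.2 (pow_lt_one₀ (norm_nonneg _) hlt hR.ne'))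

/-! ### Cubes in self-similar sets -/

/-- Two contractions of the same ratio that preserve `F` place arbitrarily long cubes in `F`. -/
theorem exists_cube_subset {F : Set ℝ} (hne : F.Nonempty) {γ t₁ t₂ : ℝ}
    (h₁ : ∀ x ∈ F, γ * x + t₁ ∈ F) (h₂ : ∀ x ∈ F, γ * x + t₂ ∈ F) (n : ℕ) :
    ∃ u, ∀ ε : ℕ → ℝ, (∀ k, ε k = 0 ∨ ε k = 1) →
      u + ∑ k ∈ Finset.range n, ε k * ((t₁ - t₂) * γ ^ k) ∈ F := by
  induction n with
  | zero => exact ⟨hne.some, fun ε _ => by simpa using hne.some_mem⟩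
  | succ n ih =>
    obtain ⟨u, hu⟩ := ih
    refine ⟨γ * u + t₂, fun ε hε => ?_⟩
    have hmem := hu (fun k => ε (k + 1)) fun k => hε _
    have hsum : ∑ k ∈ Finset.range n, ε (k + 1) * ((t₁ - t₂) * γ ^ (k + 1)) =
        γ * ∑ k ∈ Finset.range n, ε (k + 1) * ((t₁ - t₂) * γ ^ k) := by
      rw [Finset.mul_sum]
      exact Finset.sum_congr rfl fun k _ => by ring
    rw [Finset.sum_range_succ', hsum]
    rcases hε 0 with h0 | h0
    · convert h₂ _ hmem using 1
      rw [h0]; ring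
    · convert h₁ _ hmem using 1
      rw [h0]; ring

/-- A compact set covered by its images under contractions with a common fixed point is a
single point. -/
theorem not_nontrivial_of_common_fixedPoint {m : ℕ} {r b : Fin m → ℝ} (hr : ∀ j, |r j| < 1) {F : Set ℝ}
    (hF : IsCompact F) (hsub : ∀ x ∈ F, ∃ j, ∃ y ∈ F, r j * y + b j = x) {p : ℝ}
    (hp : ∀ j, r j * p + b j = p) : ¬ F.Nontrivial := by
  intro hnt
  obtain ⟨x, hx, hmax⟩ := hF.exists_isMaxOn hnt.nonempty
    (continuous_abs.comp (continuous_id.sub (continuous_const (y := p)))).continuousOn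
  have hmax' : ∀ y ∈ F, |y - p| ≤ |x - p| := fun y hy => hmax hy
  obtain ⟨j, y, hy, hyx⟩ := hsub x hx
  have h1 : |x - p| = |r j| * |y - p| := by
    rw [← abs_mul]
    congr 1
    linear_combination hp j - hyx
  have hx0 : |x - p| = 0 := by
    by_contra hne
    have hpos : 0 < |x - p| := lt_of_le_of_ne (abs_nonneg _) (Ne.symm hne)
    nlinarith [hmax' y hy, hr j, abs_nonneg (r j), abs_nonneg (y - p)]
  obtain ⟨y₁, hy₁, y₂, hy₂, hne⟩ := hnt
  have : ∀ y ∈ F, y = p := fun y hy => by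
    have := hmax' y hy
    rw [hx0] at this
    linarith [abs_nonpos_iff.1 this]
  exact hne (by rw [this _ hy₁, this _ hy₂])

/-- Two non-commuting similitudes preserving a set that embeds affinely in `E`: the product of their
ratios is multiplicatively dependent on `θ` and lies in `ℚ(θ)`. -/
theorem IsPisot.log_rational_and_mem_of_noncommuting {θ α : ℝ} (hθ : IsPisot θ) (hθα : θ * α = 1)
    {l : ℕ} (hlθ : l < θ) {a : Fin l → ℝ} (ha : ∀ i, a i ∈ Algebra.adjoin ℤ ({θ} : Set ℝ))
    {E : Set ℝ} (hE : IsCompact E) (hsub : E ⊆ ⋃ i, (fun x => α * x + a i) '' E)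
    {F : Set ℝ} (hne : F.Nonempty) (hFE : AffinelyEmbeds F E) {r₁ r₂ b₁ b₂ : ℝ}
    (hr₁ : r₁ ≠ 0) (hr₁' : |r₁| < 1) (hr₂ : r₂ ≠ 0) (hr₂' : |r₂| < 1)
    (h₁ : ∀ x ∈ F, r₁ * x + b₁ ∈ F) (h₂ : ∀ x ∈ F, r₂ * x + b₂ ∈ F)
    (hcomm : r₁ * b₂ + b₁ ≠ r₂ * b₁ + b₂) :
    (∃ q : ℚ, Real.log |r₁ * r₂|⁻¹ / Real.log θ = q) ∧ r₁ * r₂ ∈ ℚ⟮θ⟯ := by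
  obtain ⟨S, η, hη, hS, hprod⟩ := hθ.exists_frequencies hθα hlθ ha hE hsub
  obtain ⟨c, e, hc, hce⟩ := hFE
  set γ := r₁ * r₂
  set D := c * ((r₁ * b₂ + b₁) - (r₂ * b₁ + b₂))
  have hγ0 : γ ≠ 0 := mul_ne_zero hr₁ hr₂
  have hγ1 : |γ| < 1 := by
    rw [abs_mul]
    exact mul_lt_one_of_nonneg_of_lt_one_left (abs_nonneg _) hr₁' hr₂'.le
  have hD : D ≠ 0 := mul_ne_zero hc (sub_ne_zero.2 hcomm)
  have h : ∀ m n : ℕ, ∃ s ∈ S,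
      η ≤ ∏ k ∈ Finset.range n, |Real.cos (Real.pi * (s * (θ ^ m * (D * γ ^ k))))| := fun m n => by
    obtain ⟨u, hu⟩ := exists_cube_subset hne (γ := γ) (t₁ := r₁ * b₂ + b₁) (t₂ := r₂ * b₁ + b₂)
      (fun x hx => by convert h₁ _ (h₂ _ hx) using 1; ring)
      (fun x hx => by convert h₂ _ (h₁ _ hx) using 1; ring) n
    refine hprod m n (c * u + e) (fun k => D * γ ^ k) fun ε hε => ?_
    have := hce ⟨_, hu ε hε, rfl⟩
    simp only [mul_add, Finset.mul_sum] at this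
    convert this using 1
    rw [add_right_comm]
    congr 2
    exact Finset.sum_congr rfl fun k _ => by ring
  obtain ⟨q, hq⟩ := rational_log_div_log_of_prod_cos_ge hθ.2.1 hγ0 hγ1 hD hη (fun s hs => (hS s hs).1) h
  refine ⟨⟨q, hq⟩, ?_⟩
  obtain ⟨Q, R, hQ, hR, hQR⟩ := exists_pow_eq_pow_of_log_div_log_eq
    ((one_lt_inv₀ (abs_pos.2 hγ0)).2 hγ1) hθ.2.1 hq
  -- even exponents absorb the sign of `γ`
  refine mem_adjoin_of_prod_cos_ge hθ.1 hθ.2.1 hγ0 hD hη hS h (Q := 2 * Q) (R := 2 * R)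
    (by omega) (by omega) ?_
  rw [mul_comm 2 R, pow_mul θ, ← hQR, ← pow_mul, mul_comm Q 2, pow_mul, pow_mul, ← abs_inv, sq_abs]

theorem theorem1p5
    (α θ : ℝ) (hθα : θ = 1 / α) (hθ : IsPisot θ) (hθ2 : 2 < θ)
    (l : ℕ) (hl : 2 ≤ l) (hlθ : (l : ℝ) < θ)
    (a : Fin l → ℝ) (ha : ∀ i, a i ∈ Algebra.adjoin ℤ ({θ} : Set ℝ))
    (E : Set ℝ) (hE : IsAttractor (fun i x => α * x + a i) E)
    (m : ℕ) (β : Fin m → ℝ) (hβ : ∀ j, 0 < β j ∧ β j < 1)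
    (O : Fin m → (ℝ ≃ₗᵢ[ℝ] ℝ)) (b : Fin m → ℝ)
    (F : Set ℝ) (hF : IsAttractor (fun j => similitude (β j) (O j) (b j)) F)
    (hFnt : F.Nontrivial)
    (hFE : AffinelyEmbeds F E) :
    ∀ j, (∃ q : ℚ, Real.log (β j) / Real.log α = (q : ℝ)) ∧ IsPisot (1 / β j) := by
  intro j
  have hθ1 : 1 < θ := hθ.2.1
  have hα0 : α ≠ 0 := by
    rintro rfl
    rw [div_zero] at hθα
    linarith
  have hθα' : θ * α = 1 := by rw [hθα, one_div_mul_cancel hα0]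
  obtain ⟨-, hEc, hEeq⟩ := hE
  obtain ⟨hFne, hFc, hFeq⟩ := hF
  -- `O i` is multiplication by `O i 1 = ±1`, so `r i` is the signed ratio
  let r : Fin m → ℝ := fun i => β i * O i 1
  have hO : ∀ i, |O i 1| = 1 := fun i => by
    rw [← Real.norm_eq_abs, (O i).norm_map, norm_one]
  have hsim : ∀ i x, similitude (β i) (O i) (b i) x = r i * x + b i := fun i x => by
    have : O i x = x * O i 1 := by
      have := (O i).map_smul x 1
      simpa using this
    simp only [similitude, r, this]
    ring
  have hrabs : ∀ i, |r i| = β i := fun i => by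
    rw [abs_mul, hO, mul_one, abs_of_pos (hβ i).1]
  have hr0 : ∀ i, r i ≠ 0 := fun i => abs_pos.1 (by rw [hrabs]; exact (hβ i).1)
  have hr1 : ∀ i, |r i| < 1 := fun i => by rw [hrabs]; exact (hβ i).2
  have hmaps : ∀ i, ∀ x ∈ F, r i * x + b i ∈ F := fun i x hx => by
    rw [hFeq]
    exact mem_iUnion.2 ⟨i, x, hx, hsim i x⟩
  have hcov : ∀ x ∈ F, ∃ i, ∃ y ∈ F, r i * y + b i = x := fun x hx => by
    rw [hFeq] at hx
    obtain ⟨i, y, hy, hyx⟩ := mem_iUnion.1 hx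
    exact ⟨i, y, hy, by rw [← hsim]; exact hyx⟩
  -- a map that does not commute with the `j`-th one
  obtain ⟨i, hi⟩ : ∃ i, r j * b i + b j ≠ r i * b j + b i := by
    by_contra! hcon
    have h1 : 1 - r j ≠ 0 := by have := (abs_lt.1 (hr1 j)).2; linarith
    refine not_nontrivial_of_common_fixedPoint hr1 hFc hcov (p := b j / (1 - r j)) (fun i => ?_) hFnt
    field_simp
    linear_combination -hcon i
  have hj1 : 0 < 1 + r j := by have := (abs_lt.1 (hr1 j)).1; linarith
  -- the commutator defect of `(ψ_j ∘ ψ_j, ψ_i)` is `1 + r j` times that of `(ψ_j, ψ_i)`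
  obtain ⟨⟨q₁, hq₁⟩, hm₁⟩ := hθ.log_rational_and_mem_of_noncommuting hθα' hlθ ha hEc hEeq.subset hFne hFE
    (hr0 j) (hr1 j) (hr0 i) (hr1 i) (hmaps j) (hmaps i) hi
  obtain ⟨⟨q₂, hq₂⟩, hm₂⟩ := hθ.log_rational_and_mem_of_noncommuting hθα' hlθ ha hEc hEeq.subset hFne hFE
    (r₁ := r j ^ 2) (b₁ := (1 + r j) * b j) (pow_ne_zero 2 (hr0 j))
    (by rw [abs_pow]; exact pow_lt_one₀ (abs_nonneg _) (hr1 j) two_ne_zero) (hr0 i) (hr1 i)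
    (fun x hx => by convert hmaps j _ (hmaps j _ hx) using 1; ring) (hmaps i)
    (fun h => hi (mul_left_cancel₀ hj1.ne' (by linear_combination h)))
  have hβj := hβ j
  have hw : 1 < 1 / β j := (one_lt_div hβj.1).2 hβj.2
  have hlogθ := Real.log_pos hθ1
  have hlog : Real.log (1 / β j) / Real.log θ = ((q₂ - q₁ : ℚ) : ℝ) := by
    push_cast
    rw [← hq₁, ← hq₂, ← sub_div]
    congr 1
    have h1 : |r j * r i| ≠ 0 := abs_ne_zero.2 (mul_ne_zero (hr0 j) (hr0 i))
    rw [show r j ^ 2 * r i = r j * (r j * r i) by ring, abs_mul (r j) (r j * r i), hrabs,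
      Real.log_inv, Real.log_inv, Real.log_mul hβj.1.ne' h1, one_div, Real.log_inv]
    ring
  have hrmem : r j ∈ ℚ⟮θ⟯ := by
    have : r j = r j ^ 2 * r i / (r j * r i) := by
      have h1 := hr0 j
      have h2 := hr0 i
      field_simp
    rw [this]
    exact div_mem hm₂ hm₁
  have hwmem : 1 / β j ∈ ℚ⟮θ⟯ := by
    refine div_mem (one_mem _) ?_
    rw [← hrabs]
    rcases abs_choice (r j) with h | h <;> rw [h]
    · exact hrmem
    · exact neg_mem hrmem
  refine ⟨⟨q₂ - q₁, ?_⟩, ?_⟩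
  · rw [← hlog, hθα, one_div, one_div, Real.log_inv, Real.log_inv, neg_div_neg_eq]
  · obtain ⟨Q, R, hQ, hR, hQR⟩ := exists_pow_eq_pow_of_log_div_log_eq hw hθ1 hlog
    exact hθ.of_pow_eq_pow hw hwmem hQ hR hQR
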